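/- Let $n \ge 14$ and let $G$ be a loopless multigraph on $n$ vertices whose edges are coloured with two colours, such that no two parallel edges have the same colour and every vertex is incident with edges of both colours (that is, $G$ has rainbow degree 2). If $G$ has at least $\binom{n}{2}+\binom{n-3}{2}+4$ edges, then $G$ has a proper Hamiltonian path, i.e. a path that contains all the vertices of $G$ and in which any two consecutive edges have different colours. Moreover, for odd $n$ the bound on the number of edges is tight: for every odd $n \ge 14$ there is such a multigraph on $n$ vertices, of rainbow degree 2, with exactly $\binom{n}{2}+\binom{n-3}{2}+3$ edges and without a proper Hamiltonian path. -/

import Mathlib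

/-- A multigraph on the vertex set `V` whose edges are coloured with colours from `C`, without loops
and without two parallel edges of the same colour.  It is given by its colour classes:
`G.colourClass i` is the simple graph on `V` formed by the edges of colour `i`, so that two vertices
are joined by at most one edge of each colour, but possibly by several edges of distinct colours. -/
structure EdgeColouredMultigraph (V : Type*) (C : Type*) where
  /-- The spanning subgraph formed by the edges of a given colour. -/
  colourClass : C → SimpleGraph V

namespace EdgeColouredMultigraph

variable {V : Type*} {C : Type*}

/-- The number of edges: parallel edges (of distinct colours) are all counted. -/
noncomputable def numEdges [Fintype C] (G : EdgeColouredMultigraph V C) : ℕ :=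
  ∑ i : C, (G.colourClass i).edgeSet.ncard

/-- The rainbow degree of a vertex `x`: the number of different colours on the edges incident
to `x`. -/
noncomputable def vertexRainbowDegree (G : EdgeColouredMultigraph V C) (x : V) : ℕ :=
  {i : C | ∃ y : V, (G.colourClass i).Adj x y}.ncard

/-- The rainbow degree of a multigraph: the minimum rainbow degree among its vertices. -/
noncomputable def rainbowDegree (G : EdgeColouredMultigraph V C) : ℕ :=
  ⨅ x : V, G.vertexRainbowDegree x

/-- The vertices `v 0, v 1, …, v k`, together with edges joining `v i` and `v (i + 1)` of colour
`c i`, form a properly coloured path: the vertices are distinct, the edges are present,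
and consecutive edges have different colours. -/
structure IsProperPath (G : EdgeColouredMultigraph V C) {k : ℕ}
    (v : Fin (k + 1) → V) (c : Fin k → C) : Prop where
  injective : Function.Injective v
  adj : ∀ i : Fin k, (G.colourClass (c i)).Adj (v i.castSucc) (v i.succ)
  proper : ∀ i j : Fin k, (i : ℕ) + 1 = (j : ℕ) → c i ≠ c j

/-- There is a properly coloured path that contains all the vertices. -/
def HasProperHamiltonianPath (G : EdgeColouredMultigraph V C) : Prop :=
  ∃ (k : ℕ) (v : Fin (k + 1) → V) (c : Fin k → C),
    G.IsProperPath v c ∧ ∀ x : V, ∃ i, v i = x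

end EdgeColouredMultigraph

/-! ### Matchings and alternating Hamiltonian cycles -/

section AlternatingCycles

open Finset

variable {W : Type*}

/-! The edge bound leaves at most 3n - 10 missing edges over both colours. Let c be a colour missing
at least as many as the other, so that c + 1 misses at most half of them. Make the order even by
adding one or two vertices joined to everything in both colours. A perfect matching of colour c is
extended to a Hamiltonian cycle whose other edges have colour c + 1; cutting out the new vertices
leaves a proper path.

The matching comes from Tutte's theorem (`le_degSumOn_of_forall_not_isPerfectMatching`): a deficient
set would force more than 3n - 10 missing edges of colour c. The cycle comes from contraction
(`exists_isMatchingCycle_step`): for y, z joined in colour c + 1, delete them and pair their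
partners with each other; a cycle of the smaller instance expands through y, z. Choosing y, z of
large degree in the graph H of missing edges keeps H sparse enough for induction.

For even n the cycle breaks into one path only if the two new vertices are matched together. If
colour c misses fewer than 2n - 5 edges, G itself has a perfect matching and this can be arranged.
Otherwise c + 1 misses at most n - 5 edges; then the partners of the new vertices are paired by a
fictitious edge, and the cycle is cut there.

For sharpness, three vertices share their only neighbour in colour 0, whereas the colour 0 edges of
a proper Hamiltonian path of odd order form a matching missing just one vertex. -/

/-- The vertices `x, m x` for `x` running through the list `l`. -/
def pairList (m : Equiv.Perm W) (l : List W) : List W :=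
  l.flatMap fun x => [x, m x]

@[simp]
theorem pairList_nil (m : Equiv.Perm W) : pairList m [] = [] := rfl

@[simp]
theorem pairList_cons (m : Equiv.Perm W) (a : W) (l : List W) :
    pairList m (a :: l) = a :: m a :: pairList m l := rfl

@[simp]
theorem pairList_append (m : Equiv.Perm W) (l₁ l₂ : List W) :
    pairList m (l₁ ++ l₂) = pairList m l₁ ++ pairList m l₂ := by
  simp [pairList]

theorem pairList_congr {m m' : Equiv.Perm W} {l : List W} (h : ∀ x ∈ l, m x = m' x) :
    pairList m l = pairList m' l := by
  induction l with
  | nil => rfl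
  | cons a l ih => simp_all

theorem mem_pairList {m : Equiv.Perm W} {l : List W} {w : W} :
    w ∈ pairList m l ↔ ∃ x ∈ l, w = x ∨ w = m x := by
  simp [pairList]

theorem isChain_concat_imp {R S : W → W → Prop} {l : List W} {c : W}
    (h : ∀ u v, u ∈ l → R u v → S u v) (hl : List.IsChain R (l ++ [c])) :
    List.IsChain S (l ++ [c]) := by
  induction l with
  | nil => simp
  | cons a l ih =>
    cases l with
    | nil => simp_all
    | cons b l =>
      simp only [List.cons_append, List.isChain_cons_cons] at hl ih ⊢
      exact ⟨h _ _ (by simp) hl.1, ih (fun u v hu => h u v (List.mem_cons_of_mem _ hu)) hl.2⟩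

/-- The closed walk `a, m a, x₁, m x₁, x₂, m x₂, …, a`, where `l = [x₁, x₂, …]`, visits every vertex
of `X` exactly once, and its edges outside the matching `m` avoid the graph `H`. -/
structure IsMatchingCycle (m : Equiv.Perm W) (H : SimpleGraph W) (X : Finset W) (a : W)
    (l : List W) : Prop where
  nodup : (pairList m (a :: l)).Nodup
  mem_iff : ∀ w, w ∈ pairList m (a :: l) ↔ w ∈ X
  chain : List.IsChain (fun u v => ¬ H.Adj (m u) v) (a :: (l ++ [a]))

variable {m : Equiv.Perm W} {H : SimpleGraph W} {X : Finset W}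

theorem IsMatchingCycle.rotate {a b : W} {l₁ l₂ : List W}
    (h : IsMatchingCycle m H X a (l₁ ++ b :: l₂)) : IsMatchingCycle m H X b (l₂ ++ a :: l₁) := by
  have hp : (pairList m (b :: (l₂ ++ a :: l₁))).Perm (pairList m (a :: (l₁ ++ b :: l₂))) := by
    rw [← List.cons_append, pairList_append, ← List.cons_append, pairList_append]
    exact List.perm_append_comm
  refine ⟨hp.nodup_iff.2 h.nodup, fun w => by rw [hp.mem_iff, h.mem_iff], ?_⟩
  have h1 := h.chain
  -- Split the closed chain at `b` and glue the two halves together at `a`.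
  rw [List.append_assoc, List.cons_append, ← List.cons_append, List.isChain_split] at h1
  have h2 := h1.2
  rw [← List.cons_append] at h2
  have := List.isChain_split.2 ⟨h2, h1.1⟩
  simpa using this

theorem pairList_reverse_perm (hm : ∀ w, m (m w) = w) (l : List W) :
    (pairList m (l.reverse.map m)).Perm (pairList m l) := by
  induction l with
  | nil => simp
  | cons a l ih =>
    simp only [List.reverse_cons, List.map_append, List.map_cons, List.map_nil, pairList_append,
      pairList_cons, hm, pairList_nil]
    refine List.perm_append_comm.trans ?_
    simpa using (List.Perm.swap _ _ _).trans ((ih.cons _).cons _)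

theorem IsMatchingCycle.reverse (hm : ∀ w, m (m w) = w) {a : W} {l : List W}
    (h : IsMatchingCycle m H X a l) : IsMatchingCycle m H X (m a) (l.reverse.map m) := by
  have hp : (pairList m (m a :: l.reverse.map m)).Perm (pairList m (a :: l)) := by
    have := pairList_reverse_perm hm l
    simp only [pairList_cons, hm]
    exact (List.Perm.swap _ _ _).trans ((this.cons _).cons _)
  refine ⟨hp.nodup_iff.2 h.nodup, fun w => by rw [hp.mem_iff, h.mem_iff], ?_⟩
  have h1 := h.chain
  have h2 : (m a :: (l.reverse.map m ++ [m a])) = (a :: (l ++ [a])).reverse.map m := by simp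
  rw [h2, List.isChain_map]
  rw [List.isChain_reverse]
  refine h1.imp fun u v huv => ?_
  rwa [hm, H.adj_comm]

/-- Rotation reaches the first vertex of each pair; the second ones need the reversed cycle. -/
theorem IsMatchingCycle.exists_start (hm : ∀ w, m (m w) = w) {a b : W} {l : List W}
    (h : IsMatchingCycle m H X a l) (hb : b ∈ X) : ∃ l', IsMatchingCycle m H X b l' := by
  have key : ∀ a l, IsMatchingCycle m H X a l → b ∈ a :: l → ∃ l', IsMatchingCycle m H X b l' := by
    intro a l h hb
    rcases List.mem_cons.1 hb with rfl | hb
    · exact ⟨l, h⟩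
    · obtain ⟨l₁, l₂, rfl⟩ := List.append_of_mem hb
      exact ⟨_, h.rotate⟩
  obtain ⟨x, hx, hbx⟩ := mem_pairList.1 ((h.mem_iff b).2 hb)
  rcases hbx with rfl | rfl
  · exact key a l h hx
  · exact key _ _ (h.reverse hm) (by simpa using hx)

variable [DecidableEq W]

/-- The matching obtained from `m` by exchanging the roles of `y` and `m x'`: if `m` pairs
`x` with `y` and `x'` with `y'`, then the new one pairs `x` with `y'` and `x'` with `y`. -/
def exchange (m : Equiv.Perm W) (y x' : W) : Equiv.Perm W :=
  Equiv.swap y (m x') * m * Equiv.swap y (m x')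

theorem exchange_exchange (hm : ∀ w, m (m w) = w) (y x' w : W) :
    exchange m y x' (exchange m y x' w) = w := by
  simp [exchange, hm]

theorem exchange_apply_of_ne {y x' w : W} (hm : ∀ w, m (m w) = w) (h1 : w ≠ y) (h2 : w ≠ x')
    (h3 : w ≠ m y) (h4 : w ≠ m x') : exchange m y x' w = m w := by
  have h5 : m w ≠ y := fun h => h3 (by rw [← h, hm])
  have h6 : m w ≠ m x' := fun h => h2 (m.injective h)
  simp [exchange, Equiv.swap_apply_of_ne_of_ne, *]

theorem exchange_apply_partner {y x' : W} (hm : ∀ w, m (m w) = w) (hfix : m y ≠ y)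
    (hne : y ≠ x') : exchange m y x' (m y) = m x' := by
  have h6 : m y ≠ m x' := fun h => hne (m.injective h)
  simp [exchange, Equiv.swap_apply_of_ne_of_ne, *]

/-- Uncontracting a pair of matching edges joined by an edge outside `H`. -/
theorem exists_isMatchingCycle_of_exchange (hm : ∀ w, m (m w) = w) (hfix : ∀ w, m w ≠ w)
    (hX : ∀ w ∈ X, m w ∈ X) {y x' : W} (hy : y ∈ X) (hx' : x' ∈ X) (hne : y ≠ x')
    (hpar : m y ≠ x') (hadj : ¬ H.Adj y x')
    (h : ∃ a l, IsMatchingCycle (exchange m y x') H ((X.erase y).erase x') a l) :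
    ∃ a l, IsMatchingCycle m H X a l := by
  obtain ⟨a, l, h⟩ := h
  have hx : m y ∈ (X.erase y).erase x' := by simp [hpar, hfix, hX y hy]
  obtain ⟨l, h⟩ := h.exists_start (exchange_exchange hm y x') hx
  have hex := exchange_apply_partner hm (hfix y) hne
  have hnd := h.nodup
  have hmem := h.mem_iff
  simp only [pairList_cons, hex] at hnd hmem
  have hl : ∀ w ∈ l, w ≠ y ∧ w ≠ x' ∧ w ≠ m y ∧ w ≠ m x' := by
    intro w hw
    have hw' : w ∈ pairList (exchange m y x') l := mem_pairList.2 ⟨w, hw, Or.inl rfl⟩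
    have h1 := (hmem w).1 (by simp [hw'])
    simp only [mem_erase] at h1
    simp only [List.nodup_cons, List.mem_cons, not_or] at hnd
    refine ⟨h1.2.1, h1.1, ?_, ?_⟩
    · rintro rfl; exact hnd.1.2 hw'
    · rintro rfl; exact hnd.2.1 hw'
  have hagree : ∀ w ∈ l, exchange m y x' w = m w := fun w hw =>
    exchange_apply_of_ne hm (hl w hw).1 (hl w hw).2.1 (hl w hw).2.2.1 (hl w hw).2.2.2
  rw [pairList_congr hagree] at hnd hmem
  -- The smaller cycle starts `m y, m x'`; insert `y, x'` between them.
  refine ⟨m y, x' :: l, ?_, ?_, ?_⟩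
  · have hyn := (hmem y).not.2 (by simp)
    have hxn := (hmem x').not.2 (by simp)
    simp only [pairList_cons, hm, List.nodup_cons, List.mem_cons, not_or] at hnd hyn hxn ⊢
    exact ⟨⟨hfix y, hpar, hnd.1.1, hnd.1.2⟩, ⟨hne, hyn.2.1, hyn.2.2⟩,
      ⟨hxn.2.1, hxn.2.2⟩, hnd.2.1, hnd.2.2⟩
  · intro w
    have := hmem w
    simp only [pairList_cons, hm, List.mem_cons, mem_erase] at this ⊢
    by_cases h1 : w = y
    · simp [h1, hy]
    by_cases h2 : w = x'
    · simp [h2, hx']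
    simpa [h1, h2] using this
  · have hc := h.chain
    rw [List.cons_append, List.isChain_cons_cons]
    refine ⟨by rwa [hm], ?_⟩
    cases l with
    | nil => simpa [hex] using hc
    | cons b l =>
      rw [List.cons_append, List.isChain_cons_cons] at hc ⊢
      rw [hex] at hc
      refine ⟨hc.1, ?_⟩
      refine isChain_concat_imp (l := b :: l) (fun u v hu huv => ?_) hc.2
      rwa [← hagree u hu]

end AlternatingCycles

/-! ### Extending a matching to a cycle when few edges are missing -/

section MissingEdges

open Finset

variable {W : Type*} (H : SimpleGraph W) [DecidableRel H.Adj]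

/-- The number of neighbours of `y` in the vertex set `X`. -/
def degOn (X : Finset W) (y : W) : ℕ :=
  #{z ∈ X | H.Adj y z}

/-- Twice the number of edges inside the vertex set `X`. -/
def degSumOn (X : Finset W) : ℕ :=
  ∑ y ∈ X, degOn H X y

variable {H}

theorem degOn_mono {X Y : Finset W} (h : X ⊆ Y) (y : W) : degOn H X y ≤ degOn H Y y :=
  card_le_card (filter_subset_filter _ h)

theorem degOn_eq_sum (X : Finset W) (y : W) :
    degOn H X y = ∑ z ∈ X, if H.Adj y z then 1 else 0 := by
  rw [degOn, card_filter]

theorem sum_degOn_comm (X Y : Finset W) : ∑ y ∈ X, degOn H Y y = ∑ y ∈ Y, degOn H X y := by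
  simp only [degOn_eq_sum]
  rw [sum_comm]
  simp [H.adj_comm]

variable [DecidableEq W]

theorem degSumOn_erase {X : Finset W} {y : W} (hy : y ∈ X) :
    degSumOn H (X.erase y) + 2 * degOn H X y = degSumOn H X := by
  have h1 : ∀ z, degOn H X z = degOn H (X.erase y) z + if H.Adj z y then 1 else 0 := by
    intro z
    rw [degOn_eq_sum, degOn_eq_sum, sum_erase_add _ _ hy]
  have h2 : degOn H X y = ∑ z ∈ X.erase y, if H.Adj z y then 1 else 0 := by
    rw [h1 y, degOn_eq_sum]
    simp [H.adj_comm]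
  have h3 : degSumOn H X = ∑ z ∈ X.erase y, degOn H X z + degOn H X y :=
    (sum_erase_add _ _ hy).symm
  rw [h3, sum_congr rfl fun z _ => h1 z, sum_add_distrib, ← h2, degSumOn]
  ring

/-- Non-adjacency ensures that no edge is lost twice. -/
theorem degSumOn_erase_erase {X : Finset W} {y z : W} (hy : y ∈ X) (hz : z ∈ X) (hne : y ≠ z)
    (hadj : ¬ H.Adj y z) :
    degSumOn H ((X.erase y).erase z) + 2 * degOn H X y + 2 * degOn H X z = degSumOn H X := by
  have h1 := degSumOn_erase (H := H) (mem_erase.2 ⟨hne.symm, hz⟩)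
  have h2 := degSumOn_erase (H := H) hy
  have h3 : degOn H (X.erase y) z = degOn H X z := by
    unfold degOn
    congr 1
    ext w
    simp only [mem_filter, mem_erase]
    refine ⟨fun h => ⟨h.1.2, h.2⟩, fun h => ⟨⟨?_, h.1⟩, h.2⟩⟩
    rintro rfl
    exact hadj h.2.symm
  rw [h3] at h1
  omega

theorem even_degSumOn (X : Finset W) : Even (degSumOn H X) := by
  induction X using Finset.induction_on with
  | empty => simp [degSumOn]
  | insert a s ha ih =>
    rw [← degSumOn_erase (mem_insert_self a s), erase_insert ha]
    exact ih.add (even_two_mul _)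

/-- A vertex with few neighbours has a non-neighbour in `X`, other than two given vertices. -/
theorem exists_not_adj_of_degOn_lt {X : Finset W} {y : W} (a b : W)
    (h : degOn H X y + 2 < #X) : ∃ z ∈ X, z ≠ a ∧ z ≠ b ∧ ¬ H.Adj y z := by
  by_contra! hcon
  have hsub : X ⊆ insert a (insert b {z ∈ X | H.Adj y z}) := by
    intro z hz
    simp only [mem_insert, mem_filter]
    by_cases h1 : z = a
    · exact Or.inl h1
    by_cases h2 : z = b
    · exact Or.inr (Or.inl h2)
    exact Or.inr (Or.inr ⟨hz, hcon z hz h1 h2⟩)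
  have h1 := card_le_card hsub
  have h2 := card_insert_le a (insert b {z ∈ X | H.Adj y z})
  have h3 := card_insert_le b {z ∈ X | H.Adj y z}
  unfold degOn at h
  omega

theorem exchange_mem {m : Equiv.Perm W} (hm : ∀ w, m (m w) = w) {X : Finset W}
    (hX : ∀ w ∈ X, m w ∈ X) {y x' : W} (hy : y ∈ X) (hx' : x' ∈ X) (hfix : ∀ w, m w ≠ w)
    (hne : y ≠ x') (hpar : m y ≠ x') :
    ∀ w ∈ (X.erase y).erase x', exchange m y x' w ∈ (X.erase y).erase x' := by
  intro w hw
  simp only [mem_erase] at hw ⊢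
  obtain ⟨h1, h2, h3⟩ := hw
  have hpar' : m x' ≠ y := fun h => hpar (by rw [← h, hm])
  by_cases h4 : w = m y
  · subst h4
    rw [exchange_apply_partner hm (hfix y) hne]
    exact ⟨hfix x', hpar', hX _ hx'⟩
  by_cases h5 : w = m x'
  · subst h5
    have : exchange m y x' (m x') = m y := by
      rw [← exchange_apply_partner hm (hfix y) hne, exchange_exchange hm]
    rw [this]
    exact ⟨hpar, hfix y, hX _ hy⟩
  rw [exchange_apply_of_ne hm h2 h1 h4 h5]
  exact ⟨fun h => h5 (by rw [← h, hm]), fun h => h4 (by rw [← h, hm]), hX _ h3⟩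

theorem exchange_ne_self {m : Equiv.Perm W} (hfix : ∀ w, m w ≠ w) (y x' w : W) :
    exchange m y x' w ≠ w := by
  intro h
  simp only [exchange, Equiv.Perm.mul_apply] at h
  exact hfix _ (by rw [Equiv.swap_apply_eq_iff] at h; exact h)

theorem card_erase_erase {X : Finset W} {y z : W} (hy : y ∈ X) (hz : z ∈ X) (hne : y ≠ z) :
    #((X.erase y).erase z) + 2 = #X := by
  have h1 := card_erase_add_one (mem_erase.2 ⟨hne.symm, hz⟩)
  have h2 := card_erase_add_one hy
  omega

theorem two_le_degOn {X : Finset W} {y a b : W} (ha : a ∈ X) (hb : b ∈ X) (hab : a ≠ b)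
    (h1 : H.Adj y a) (h2 : H.Adj y b) : 2 ≤ degOn H X y := by
  rw [← card_pair hab]
  refine card_le_card fun z hz => ?_
  rcases mem_insert.1 hz with rfl | hz
  · simp [ha, h1]
  · rw [mem_singleton.1 hz]
    simp [hb, h2]

/-- If all degrees in `H` are at most `D` and `H` has many edges, then a vertex `y` has a
non-neighbour that is not isolated in `H`, other than two given vertices. -/
theorem exists_not_adj_of_lt_degSumOn {X : Finset W} {D : ℕ} (hD : ∀ x ∈ X, degOn H X x ≤ D)
    {y : W} (hy : y ∈ X) (a b : W) (h : D * (D + 2) < degSumOn H X) :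
    ∃ z ∈ X, z ≠ a ∧ z ≠ b ∧ ¬ H.Adj y z ∧ 1 ≤ degOn H X z := by
  have h1 : degSumOn H X ≤ #{x ∈ X | 1 ≤ degOn H X x} * D := by
    rw [degSumOn, ← sum_filter_add_sum_filter_not X fun x => 1 ≤ degOn H X x]
    have h2 : ∑ x ∈ X with ¬ 1 ≤ degOn H X x, degOn H X x = 0 :=
      sum_eq_zero fun x hx => by
        have := (mem_filter.1 hx).2
        omega
    rw [h2, add_zero, ← smul_eq_mul]
    exact sum_le_card_nsmul _ _ _ fun x hx => hD x (mem_filter.1 hx).1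
  have h3 : D + 2 < #{x ∈ X | 1 ≤ degOn H X x} := by
    by_contra! hc
    have := Nat.mul_le_mul_right D hc
    rw [mul_comm D] at h
    omega
  have h4 := degOn_mono (H := H) (filter_subset (fun x => 1 ≤ degOn H X x) X) y
  have h5 := hD y hy
  obtain ⟨z, hz, hza, hzb, hyz⟩ := exists_not_adj_of_degOn_lt (H := H)
    (X := {x ∈ X | 1 ≤ degOn H X x}) (y := y) a b (by omega)
  exact ⟨z, (mem_filter.1 hz).1, hza, hzb, hyz, (mem_filter.1 hz).2⟩

/-- Two cycles contain both matching edges. Any other edge of the first meets any other edge of the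
second, so blocking both would give a vertex of degree 2 in `H`. -/
theorem exists_isMatchingCycle_of_card_eq_four {m : Equiv.Perm W} {X : Finset W}
    (hm : ∀ w, m (m w) = w) (hfix : ∀ w, m w ≠ w) (hX : ∀ w ∈ X, m w ∈ X) (hcard : #X = 4)
    (hdeg : ∀ x ∈ X, degOn H X x ≤ 1) : ∃ a l, IsMatchingCycle m H X a l := by
  obtain ⟨a, ha⟩ : X.Nonempty := card_pos.1 (by omega)
  obtain ⟨c, hc, hca, hcma⟩ : ∃ c ∈ X, c ≠ a ∧ c ≠ m a := by
    by_contra! h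
    have h1 : X ⊆ {a, m a} := fun z hz => by
      simp only [mem_insert, mem_singleton]
      by_contra! hz'
      exact hz'.2 (h z hz hz'.1)
    have := (card_le_card h1).trans card_le_two
    omega
  have hmca : m c ≠ a := fun h => hcma (by rw [← h, hm])
  have hmcma : m c ≠ m a := fun h => hca (m.injective h)
  have hset : ({a, m a, c, m c} : Finset W) = X := by
    refine eq_of_subset_of_card_le ?_ ?_
    · intro z hz
      simp only [mem_insert, mem_singleton] at hz
      rcases hz with rfl | rfl | rfl | rfl
      exacts [ha, hX _ ha, hc, hX _ hc]
    · have := hfix a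
      have := hfix c
      rw [hcard, card_insert_of_notMem, card_insert_of_notMem, card_insert_of_notMem,
        card_singleton] <;> simp only [mem_insert, mem_singleton] <;> grind
  have hno : ∀ y u v, y ∈ X → u ∈ X → v ∈ X → u ≠ v → H.Adj y u → H.Adj y v → False := by
    intro y u v hy hu hv huv h1 h2
    have := two_le_degOn hu hv huv h1 h2
    have := hdeg y hy
    omega
  have hma := hX a ha
  have hmc := hX c hc
  by_cases h1 : ¬ H.Adj (m a) c ∧ ¬ H.Adj (m c) a
  · refine ⟨a, [c], ?_, ?_, ?_⟩
    · have := hfix a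
      have := hfix c
      simp only [pairList_cons, pairList_nil, List.nodup_cons, List.mem_cons]
      grind
    · intro w
      rw [← hset]
      simp
    · simpa using h1
  · refine ⟨a, [m c], ?_, ?_, ?_⟩
    · have := hfix a
      have := hfix c
      simp only [pairList_cons, pairList_nil, List.nodup_cons, List.mem_cons, hm]
      grind
    · intro w
      rw [← hset]
      simp only [pairList_cons, pairList_nil, List.mem_cons, hm, mem_insert, mem_singleton]
      grind
    · have h2 : ¬ H.Adj (m a) (m c) := by
        grind [SimpleGraph.adj_comm]
      have h3 : ¬ H.Adj c a := by
        grind [SimpleGraph.adj_comm]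
      simpa [hm] using ⟨h2, h3⟩

/-- One induction step: to find a matching cycle one may contract a non-edge of `H`. -/
theorem exists_isMatchingCycle_step {m : Equiv.Perm W} (hm : ∀ w, m (m w) = w)
    (hfix : ∀ w, m w ≠ w) {X : Finset W} (hX : ∀ w ∈ X, m w ∈ X) {p : ℕ} (hp : #X = 2 * (p + 1))
    {y z : W} (hy : y ∈ X) (hz : z ∈ X) (hne : z ≠ y) (hpar : z ≠ m y) (hadj : ¬ H.Adj y z)
    (ih : ∀ m' : Equiv.Perm W, (∀ w, m' (m' w) = w) → (∀ w, m' w ≠ w) →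
      (∀ w ∈ (X.erase y).erase z, m' w ∈ (X.erase y).erase z) → #((X.erase y).erase z) = 2 * p →
      degSumOn H ((X.erase y).erase z) + 2 * degOn H X y + 2 * degOn H X z = degSumOn H X →
      ∃ a l, IsMatchingCycle m' H ((X.erase y).erase z) a l) :
    ∃ a l, IsMatchingCycle m H X a l := by
  refine exists_isMatchingCycle_of_exchange hm hfix hX hy hz hne.symm hpar.symm hadj ?_
  refine ih _ (exchange_exchange hm y z) (exchange_ne_self hfix y z)
    (exchange_mem hm hX hy hz hfix hne.symm hpar.symm) ?_
    (degSumOn_erase_erase hy hz hne.symm hadj)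
  have := card_erase_erase hy hz hne.symm
  omega

/-- A perfect matching on `2 * p` vertices extends to a Hamiltonian cycle alternating between it
and the non-edges of `H`, if `H` has at most `2 * p - 3` edges. -/
theorem exists_isMatchingCycle_of_degSumOn_le (p : ℕ) : ∀ (m : Equiv.Perm W) (X : Finset W),
    (∀ w, m (m w) = w) → (∀ w, m w ≠ w) → (∀ w ∈ X, m w ∈ X) → #X = 2 * p →
    degSumOn H X + 6 ≤ 4 * p → ∃ a l, IsMatchingCycle m H X a l := by
  induction p with
  | zero => intro m X _ _ _ _ h; omega
  | succ p ih =>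
    intro m X hm hfix hX hp hsum
    have hdeg : ∀ y ∈ X, 2 * degOn H X y ≤ degSumOn H X := fun y hy => by
      have := degSumOn_erase (H := H) hy
      omega
    -- The allowance drops by two edges with each contraction, so `y` and `z` must carry off
    -- whatever exceeds it.
    have step : ∀ y ∈ X, ∀ z ∈ X, z ≠ y → z ≠ m y → ¬ H.Adj y z →
        degSumOn H X + 2 ≤ 4 * p + 2 * degOn H X y + 2 * degOn H X z - 4 →
        ∃ a l, IsMatchingCycle m H X a l := by
      intro y hy z hz hne hpar hadj hs
      refine exists_isMatchingCycle_step hm hfix hX hp hy hz hne hpar hadj ?_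
      intro m' h1 h2 h3 h4 h5
      exact ih m' _ h1 h2 h3 h4 (by omega)
    by_cases h0 : p = 1
    · subst h0
      refine exists_isMatchingCycle_of_card_eq_four hm hfix hX hp fun x hx => ?_
      have := hdeg x hx
      omega
    by_cases hD : ∃ y ∈ X, 2 ≤ degOn H X y
    · obtain ⟨y, hy, hy2⟩ := hD
      have := hdeg y hy
      obtain ⟨z, hz, h1, h2, h3⟩ := exists_not_adj_of_degOn_lt (H := H) (X := X) (y := y) y (m y)
        (by omega)
      exact step y hy z hz h1 h2 h3 (by omega)
    push Not at hD
    by_cases hE : degSumOn H X + 6 ≤ 4 * p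
    · obtain ⟨y, hy⟩ : X.Nonempty := card_pos.1 (by omega)
      have := hD y hy
      obtain ⟨z, hz, h1, h2, h3⟩ := exists_not_adj_of_degOn_lt (H := H) (X := X) (y := y) y (m y)
        (by omega)
      exact step y hy z hz h1 h2 h3 (by omega)
    -- Now `H` is a matching with at least two edges (parity matters for `p = 2`), so `y` and `z`
    -- can both be taken non-isolated.
    have hD1 : ∀ x ∈ X, degOn H X x ≤ 1 := fun x hx => Nat.le_of_lt_succ (hD x hx)
    have heven := even_degSumOn (H := H) X
    rw [Nat.even_iff] at heven
    obtain ⟨y, hy, hy1⟩ : ∃ y ∈ X, 1 ≤ degOn H X y := by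
      by_contra! h
      have : degSumOn H X = 0 := sum_eq_zero fun x hx => Nat.lt_one_iff.1 (h x hx)
      omega
    obtain ⟨z, hz, h1, h2, h3, h4⟩ := exists_not_adj_of_lt_degSumOn hD1 hy y (m y) (by omega)
    exact step y hy z hz h1 h2 h3 (by omega)

/-- A perfect matching on `2 * p` vertices extends to a Hamiltonian cycle alternating between it
and the non-edges of `H`, if `H` has at most `3 * p - 7` edges and every vertex has a non-neighbour
in `H` besides its partner. -/
theorem exists_isMatchingCycle_of_exists_not_adj (p : ℕ) :
    ∀ (m : Equiv.Perm W) (X : Finset W),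
    (∀ w, m (m w) = w) → (∀ w, m w ≠ w) → (∀ w ∈ X, m w ∈ X) → #X = 2 * p →
    degSumOn H X + 14 ≤ 6 * p → (∀ y ∈ X, ∃ z ∈ X, z ≠ y ∧ z ≠ m y ∧ ¬ H.Adj y z) →
    ∃ a l, IsMatchingCycle m H X a l := by
  induction p with
  | zero => intro m X _ _ _ _ h; omega
  | succ p ih =>
    intro m X hm hfix hX hp hsum hadj
    by_cases h0 : degSumOn H X + 6 ≤ 4 * (p + 1)
    · exact exists_isMatchingCycle_of_degSumOn_le (p + 1) m X hm hfix hX hp h0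
    -- Deleting a vertex of degree at least p - 1 leaves at most 3(p + 1) - 7 - (p - 1) = 2p - 3
    -- edges, the bound of the previous theorem.
    by_cases hbig : ∃ y ∈ X, p ≤ degOn H X y + 1
    · obtain ⟨y, hy, hyD⟩ := hbig
      obtain ⟨z, hz, h1, h2, h3⟩ := hadj y hy
      refine exists_isMatchingCycle_step hm hfix hX hp hy hz h1 h2 h3 ?_
      intro m' h1 h2 h3 h4 h5
      exact exists_isMatchingCycle_of_degSumOn_le p m' _ h1 h2 h3 h4 (by omega)
    push Not at hbig
    -- The allowance now drops by three edges.
    obtain ⟨y, hy, z, hz, h1, h2, h3, h4⟩ : ∃ y ∈ X, ∃ z ∈ X, z ≠ y ∧ z ≠ m y ∧ ¬ H.Adj y z ∧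
        3 ≤ degOn H X y + degOn H X z := by
      by_cases hD : ∃ y ∈ X, 3 ≤ degOn H X y
      · obtain ⟨y, hy, hy3⟩ := hD
        obtain ⟨z, hz, h1, h2, h3⟩ := hadj y hy
        exact ⟨y, hy, z, hz, h1, h2, h3, by omega⟩
      push Not at hD
      have hD2 : ∀ x ∈ X, degOn H X x ≤ 2 := fun x hx => Nat.le_of_lt_succ (hD x hx)
      obtain ⟨y, hy, hy2⟩ : ∃ y ∈ X, 2 ≤ degOn H X y := by
        by_contra! h
        have : degSumOn H X ≤ #X • 1 :=
          sum_le_card_nsmul _ _ _ fun x hx => Nat.le_of_lt_succ (h x hx)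
        rw [smul_eq_mul] at this
        omega
      obtain ⟨z, hz, h1, h2, h3, h4⟩ := exists_not_adj_of_lt_degSumOn hD2 hy y (m y) (by omega)
      exact ⟨y, hy, z, hz, h1, h2, h3, by omega⟩
    refine exists_isMatchingCycle_step hm hfix hX hp hy hz h1 h2 h3 ?_
    intro m' h1 h2 h3 h4 h5
    -- All degrees are at most p - 2, so among the 2p remaining vertices the non-neighbour condition
    -- is automatic.
    refine ih m' _ h1 h2 h3 h4 (by omega) fun x hx => ?_
    have h6 : degOn H ((X.erase y).erase z) x ≤ degOn H X x :=
      degOn_mono ((erase_subset _ _).trans (erase_subset _ _)) x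
    have h7 := hbig x (mem_of_mem_erase (mem_of_mem_erase hx))
    exact exists_not_adj_of_degOn_lt x (m' x) (by omega)

end MissingEdges

/-! ### Tutte's theorem and the cost of having no perfect matching -/

section Deficiency

open Finset

variable {W : Type*}

/-- A perfect matching, as a permutation of the vertices. -/
theorem exists_perm_of_isPerfectMatching {G : SimpleGraph W} {M : G.Subgraph}
    (hM : M.IsPerfectMatching) :
    ∃ m : Equiv.Perm W, (∀ w, m (m w) = w) ∧ ∀ w, G.Adj w (m w) := by
  rw [SimpleGraph.Subgraph.isPerfectMatching_iff] at hM
  choose f hf hu using hM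
  have hff : Function.Involutive f := fun w => (hu _ _ (hf w).symm).symm
  exact ⟨hff.toPerm, hff, fun w => (hf w).adj_sub⟩

variable [Fintype W] [DecidableEq W]

/-- Tutte's theorem for graphs of even order: without a perfect matching, there is a set `u` of
vertices whose removal leaves at least `#u + 2` components of odd order. -/
theorem exists_odd_components {G : SimpleGraph W} (heven : Even (Fintype.card W))
    (hG : ∀ M : G.Subgraph, ¬ M.IsPerfectMatching) :
    ∃ (u : Finset W) (K : Fin (#u + 2) → Finset W), (∀ i, Odd #(K i)) ∧
      (∀ i, ∀ x ∈ K i, x ∉ u) ∧ (∀ i j, i ≠ j → Disjoint (K i) (K j)) ∧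
      ∀ i, ∀ x ∈ K i, ∀ y, y ∉ K i → y ∉ u → ¬ G.Adj x y := by
  classical
  obtain ⟨S, hS⟩ : ∃ S : Set W, G.IsTutteViolator S := by
    by_contra! h
    obtain ⟨M, hM⟩ := SimpleGraph.tutte.2 h
    exact hG M hM
  set G' := ((⊤ : G.Subgraph).deleteVerts S).coe with hG'
  have hcardV : Nat.card ((⊤ : G.Subgraph).deleteVerts S).verts + S.ncard = Fintype.card W := by
    have h1 : ((⊤ : G.Subgraph).deleteVerts S).verts = Sᶜ := by
      ext; simp
    rw [h1, Nat.card_coe_set_eq, add_comm, Set.ncard_add_ncard_compl, Nat.card_eq_fintype_card]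
  -- The number of odd components has the parity of `S`, since the order is even; hence an excess of
  -- one is an excess of two.
  have hodd := SimpleGraph.odd_ncard_oddComponents (G := G')
  have hle : S.toFinset.card + 2 ≤ G'.oddComponents.ncard := by
    unfold SimpleGraph.IsTutteViolator at hS
    rw [← hG'] at hS
    rw [← Set.ncard_eq_toFinset_card']
    rw [← Nat.not_even_iff_odd, ← Nat.not_even_iff_odd] at hodd
    rw [Nat.even_iff] at hodd heven
    rw [Nat.even_iff] at hodd
    omega
  obtain ⟨e⟩ : Nonempty (Fin (#S.toFinset + 2) ↪ G'.oddComponents) := by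
    apply Function.Embedding.nonempty_of_card_le
    rw [Fintype.card_fin, ← Nat.card_eq_fintype_card, Nat.card_coe_set_eq]
    exact hle
  refine ⟨S.toFinset, fun i => ((e i).1.supp.image Subtype.val).toFinset, fun i => ?_, ?_, ?_, ?_⟩
  · rw [← Set.ncard_eq_toFinset_card', Set.ncard_image_of_injective _ Subtype.val_injective]
    exact (e i).2
  · intro i x hx
    simp only [Set.mem_toFinset, Set.mem_image] at hx ⊢
    obtain ⟨x, -, rfl⟩ := hx
    exact x.2.2
  · intro i j hij
    rw [Finset.disjoint_left]
    intro x hx hy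
    simp only [Set.mem_toFinset, Set.mem_image] at hx hy
    obtain ⟨x, hx, rfl⟩ := hx
    obtain ⟨y, hy, hxy⟩ := hy
    obtain rfl := Subtype.val_injective hxy
    refine hij (e.injective (Subtype.ext ?_))
    rw [SimpleGraph.ConnectedComponent.mem_supp_iff] at hx hy
    rw [← hx, ← hy]
  · intro i x hx y hy hyS hadj
    simp only [Set.mem_toFinset, Set.mem_image] at hx hy hyS
    obtain ⟨x, hx, rfl⟩ := hx
    refine hy ⟨⟨y, by simpa using hyS⟩, ?_, rfl⟩
    rw [SimpleGraph.ConnectedComponent.mem_supp_iff] at hx ⊢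
    rw [← hx, SimpleGraph.ConnectedComponent.eq]
    refine SimpleGraph.Adj.reachable ?_
    have hxS := x.2.2
    simp only [hG', SimpleGraph.Subgraph.coe_adj, SimpleGraph.Subgraph.deleteVerts_adj,
      SimpleGraph.Subgraph.verts_top, Set.mem_univ, true_and, SimpleGraph.Subgraph.top_adj]
    exact ⟨hyS, hxS, hadj.symm⟩

variable {H : SimpleGraph W} [DecidableRel H.Adj]

theorem sum_degOn_add_sum_degOn_le {X Y : Finset W} (h : Disjoint X Y) :
    ∑ y ∈ X, degOn H univ y + ∑ y ∈ Y, degOn H X y ≤ degSumOn H univ := by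
  calc _ ≤ ∑ y ∈ X, degOn H univ y + ∑ y ∈ Y, degOn H univ y :=
        add_le_add le_rfl (sum_le_sum fun y _ => degOn_mono (subset_univ _) y)
    _ = ∑ y ∈ X ∪ Y, degOn H univ y := (sum_union h).symm
    _ ≤ _ := sum_le_sum_of_subset (subset_univ _)

/-- A complete bipartite subgraph of `H` bounds its number of edges from below. -/
theorem two_mul_card_mul_card_le_degSumOn {X Y : Finset W} (h : Disjoint X Y)
    (hadj : ∀ x ∈ X, ∀ y ∈ Y, H.Adj x y) : 2 * (#X * #Y) ≤ degSumOn H univ := by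
  have h1 : ∀ y ∈ Y, degOn H X y = #X := fun y hy => by
    rw [degOn, filter_true_of_mem fun x hx => (hadj x hx y hy).symm]
  have h2 : ∑ y ∈ Y, degOn H X y = #X * #Y := by
    rw [sum_congr rfl h1, sum_const, smul_eq_mul, mul_comm]
  have h3 : ∑ y ∈ X, degOn H Y y ≤ ∑ y ∈ X, degOn H univ y :=
    sum_le_sum fun y _ => degOn_mono (subset_univ _) y
  rw [sum_degOn_comm] at h3
  have := sum_degOn_add_sum_degOn_le (H := H) h
  omega

/-- If all vertices outside `u` are adjacent in `H` to all but at most one vertex in each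
transversal of `k` disjoint sets, then `H` has many edges. -/
theorem mul_le_degSumOn_of_transversal {u : Finset W} {k : ℕ} {K : Fin (k + 1) → Finset W}
    (hne : ∀ i, (K i).Nonempty) (hu : ∀ i, ∀ x ∈ K i, x ∉ u)
    (hdisj : ∀ i j, i ≠ j → Disjoint (K i) (K j))
    (hadj : ∀ i, ∀ x ∈ K i, ∀ y, y ∉ K i → y ∉ u → H.Adj x y) :
    #u + (k + 1) ≤ Fintype.card W ∧
      k * (Fintype.card W - #u + (Fintype.card W - #u - (k + 1))) ≤ degSumOn H univ := by
  choose a ha using hne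
  have hinj : Function.Injective a := fun i j hij => by
    by_contra h
    exact disjoint_left.1 (hdisj i j h) (ha i) (hij ▸ ha j)
  set A := univ.image a with hA
  have hAcard : #A = k + 1 := by
    rw [card_image_of_injective _ hinj, card_univ, Fintype.card_fin]
  have hAu : A ⊆ uᶜ := by
    intro x hx
    obtain ⟨i, -, rfl⟩ := mem_image.1 hx
    exact mem_compl.2 (hu i _ (ha i))
  have hdeg : ∀ y ∈ uᶜ, k ≤ degOn H A y := by
    intro y hy
    rw [mem_compl] at hy
    have : ∃ i, ∀ j, j ≠ i → y ∉ K j := by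
      by_cases h : ∃ i, y ∈ K i
      · obtain ⟨i, hi⟩ := h
        exact ⟨i, fun j hj hyj => disjoint_left.1 (hdisj j i hj) hyj hi⟩
      · push Not at h
        exact ⟨0, fun j _ => h j⟩
    obtain ⟨i, hi⟩ := this
    have hsub : A.erase (a i) ⊆ {z ∈ A | H.Adj y z} := by
      intro z hz
      obtain ⟨hz1, hz2⟩ := mem_erase.1 hz
      refine mem_filter.2 ⟨hz2, ?_⟩
      obtain ⟨j, -, rfl⟩ := mem_image.1 hz2
      exact (hadj j _ (ha j) y (hi j fun h => hz1 (by rw [h])) hy).symm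
    have := card_le_card hsub
    rw [card_erase_of_mem (mem_image_of_mem a (mem_univ i)), hAcard] at this
    exact this
  have hcu : #uᶜ = Fintype.card W - #u := card_compl u
  have hcT : #(uᶜ \ A) = Fintype.card W - #u - (k + 1) := by
    rw [card_sdiff_of_subset hAu, hcu, hAcard]
  have hle := card_le_card hAu
  have hle2 := card_le_univ u
  -- Double counting: pairs between `A` and `uᶜ` bound the degrees in `A`; vertices of `uᶜ` outside
  -- `A` contribute `k` each once more.
  have h1 : #uᶜ * k ≤ ∑ y ∈ A, degOn H univ y := by
    rw [sum_degOn_comm, ← smul_eq_mul]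
    exact (card_nsmul_le_sum _ _ _ hdeg).trans (sum_le_sum_of_subset (subset_univ _))
  have h2 : #(uᶜ \ A) * k ≤ ∑ y ∈ uᶜ \ A, degOn H A y := by
    rw [← smul_eq_mul]
    exact card_nsmul_le_sum _ _ _ fun y hy => hdeg y (sdiff_subset hy)
  have h3 := sum_degOn_add_sum_degOn_le (H := H) (X := A) (Y := uᶜ \ A) disjoint_sdiff
  refine ⟨by omega, ?_⟩
  rw [← hcT, ← hcu, mul_add, mul_comm k, mul_comm k]
  omega

/-- A lower bound on the number of non-edges of a graph `Hᶜ` of even order without a perfect matching, in which the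
vertices in `Z` are universal and the other ones have neighbours outside `Z`. -/
theorem le_degSumOn_of_forall_not_isPerfectMatching (heven : Even (Fintype.card W))
    (hG : ∀ M : Hᶜ.Subgraph, ¬ M.IsPerfectMatching) {Z : Finset W}
    (hZ : ∀ z ∈ Z, ∀ w, ¬ H.Adj z w) (hdeg : ∀ w, w ∉ Z → ∃ v, v ∉ Z ∧ Hᶜ.Adj w v) :
    ∃ s, #Z ≤ s ∧ 2 * s + 2 ≤ Fintype.card W ∧
      (s + 1) * (2 * Fintype.card W - 3 * s - 2) ≤ degSumOn H univ ∧
      (s = #Z → 6 * (Fintype.card W - #Z - 3) ≤ degSumOn H univ) := by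
  obtain ⟨u, K, hodd, hKu, hdisj, hadj⟩ := exists_odd_components heven hG
  have hne : ∀ i, (K i).Nonempty := fun i => card_pos.1 (hodd i).pos
  have hadj' : ∀ i, ∀ x ∈ K i, ∀ y, y ∉ K i → y ∉ u → H.Adj x y := fun i x hx y hy hyu => by
    have := hadj i x hx y hy hyu
    rw [SimpleGraph.compl_adj] at this
    by_contra h
    exact this ⟨fun h => hy (h ▸ hx), h⟩
  have hne01 : (0 : Fin (#u + 2)) ≠ 1 := by simp
  -- A universal vertex outside `u` would be joined to two distinct components.
  have hZu : Z ⊆ u := by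
    intro z hz
    by_contra hzu
    obtain ⟨i, hi⟩ : ∃ i, z ∉ K i := by
      by_contra! h
      exact disjoint_left.1 (hdisj 0 1 hne01) (h 0) (h 1)
    obtain ⟨x, hx⟩ := hne i
    exact hZ z hz x (hadj' i x hx z hi hzu).symm
  obtain ⟨h1, h2⟩ := mul_le_degSumOn_of_transversal (H := H) hne hKu hdisj hadj'
  refine ⟨#u, card_le_card hZu, by omega, ?_, fun hs => ?_⟩
  · convert h2 using 2
    omega
  · have hZu' : u = Z := (eq_of_subset_of_card_le hZu hs.le).symm
    -- With `u = Z`, a singleton component would be a vertex without neighbours outside `Z`.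
    have hthree : ∀ i, 3 ≤ #(K i) := by
      intro i
      by_contra! h3
      obtain ⟨t, ht⟩ := hodd i
      obtain ⟨x, hx⟩ := card_eq_one.1 (show #(K i) = 1 by omega)
      have hxK : x ∈ K i := by simp [hx]
      obtain ⟨v, hv, hxv⟩ := hdeg x (hZu' ▸ hKu i x hxK)
      refine hadj i x hxK v ?_ (hZu' ▸ hv) hxv
      rw [hx, mem_singleton]
      exact hxv.ne'
    have hsub : K 1 ⊆ uᶜ \ K 0 := fun x hx => mem_sdiff.2
      ⟨mem_compl.2 (hKu 1 x hx), disjoint_right.1 (hdisj 0 1 hne01) hx⟩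
    have hsub0 : K 0 ⊆ uᶜ := fun x hx => mem_compl.2 (hKu 0 x hx)
    have h4 := two_mul_card_mul_card_le_degSumOn (H := H) (X := K 0) (Y := uᶜ \ K 0)
      disjoint_sdiff fun x hx y hy => by
        obtain ⟨hy1, hy2⟩ := mem_sdiff.1 hy
        exact hadj' 0 x hx y hy2 (mem_compl.1 hy1)
    have h5 := card_sdiff_add_card_eq_card hsub0
    rw [card_compl] at h5
    have h6 := card_le_card hsub
    have h7 := hthree 0
    have h8 := hthree 1
    have h9 : Fintype.card W - #Z - 3 = #(uᶜ \ K 0) + #(K 0) - 3 := by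
      rw [h5, hZu']
    rw [h9]
    refine le_trans ?_ h4
    obtain ⟨c, hc⟩ := Nat.exists_eq_add_of_le h7
    obtain ⟨d, hd⟩ := Nat.exists_eq_add_of_le (h8.trans h6)
    rw [hc, hd, show 3 + d + (3 + c) - 3 = 3 + c + d by omega]
    -- If a, b ≥ 3, then (a - 3)(b - 3) ≥ 0 gives ab ≥ 3(a + b - 3).
    nlinarith [Nat.zero_le (c * d)]

end Deficiency

/-! ### From alternating lists to proper paths -/

namespace EdgeColouredMultigraph

section AlternatingLists

variable {V : Type*} (G : EdgeColouredMultigraph V (Fin 2))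

/-- Consecutive vertices of the list are joined by edges whose colours alternate, the first one
being `c`. -/
def IsAlternating : Fin 2 → List V → Prop
  | c, a :: b :: l => (G.colourClass c).Adj a b ∧ IsAlternating (c + 1) (b :: l)
  | _, _ => True

variable {G}

theorem IsAlternating.tail {c : Fin 2} {a : V} {l : List V} (h : G.IsAlternating c (a :: l)) :
    G.IsAlternating (c + 1) l := by
  cases l with
  | nil => trivial
  | cons b l => exact h.2

theorem IsAlternating.left_of_append {l₁ l₂ : List V} :
    ∀ {c : Fin 2}, G.IsAlternating c (l₁ ++ l₂) → G.IsAlternating c l₁ := by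
  induction l₁ with
  | nil => intros; trivial
  | cons a l ih =>
    intro c h
    cases l with
    | nil => trivial
    | cons b l => exact ⟨h.1, ih h.2⟩

theorem IsAlternating.adj {l : List V} : ∀ {c : Fin 2}, G.IsAlternating c l →
    ∀ (i : ℕ) (hi : i + 1 < l.length), (G.colourClass (c + i • (1 : Fin 2))).Adj l[i] l[i + 1] := by
  induction l with
  | nil => intro c _ i hi; simp at hi
  | cons a l ih =>
    intro c h i hi
    cases l with
    | nil => simp at hi
    | cons b l =>
      cases i with
      | zero => simpa using h.1
      | succ i =>
        have := ih h.2 i (by simpa using hi)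
        rw [add_assoc, ← succ_nsmul'] at this
        simpa using this

theorem fin_two_add_one_ne (c : Fin 2) : c ≠ c + 1 := by
  fin_cases c <;> decide

theorem fin_two_add_one_add_one (c : Fin 2) : c + 1 + 1 = c := by
  fin_cases c <;> rfl

theorem IsAlternating.hasProperHamiltonianPath {c : Fin 2} {l : List V}
    (h : G.IsAlternating c l) (hl : l ≠ []) (hnd : l.Nodup) (hmem : ∀ x, x ∈ l) :
    G.HasProperHamiltonianPath := by
  obtain ⟨k, hk⟩ : ∃ k, l.length = k + 1 :=
    Nat.exists_eq_succ_of_ne_zero (by simpa using hl)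
  refine ⟨k, fun i => l[(i : ℕ)], fun i => c + (i : ℕ) • (1 : Fin 2), ⟨?_, ?_, ?_⟩, ?_⟩
  · intro i j hij
    exact Fin.ext ((hnd.getElem_inj_iff).1 hij)
  · intro i
    simpa using h.adj (i : ℕ) (by omega)
  · intro i j hij
    rw [← hij, succ_nsmul, ← add_assoc]
    exact fin_two_add_one_ne _
  · intro x
    obtain ⟨i, hi, rfl⟩ := List.getElem_of_mem (hmem x)
    exact ⟨⟨i, by omega⟩, rfl⟩

/-- Only the matching edges at `l` need colour `c`; the one at which the cycle is cut may be
fictitious. -/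
theorem isAlternating_pairList {H : SimpleGraph V} {m : Equiv.Perm V} {c : Fin 2}
    (hB : ∀ u v, u ≠ v → ¬ H.Adj u v → (G.colourClass (c + 1)).Adj u v) {a : V} {l : List V} :
    ∀ {y : V}, List.IsChain (fun u v => ¬ H.Adj (m u) v) (y :: (l ++ [a])) →
      (m y :: (pairList m l ++ [a])).Nodup →
      (∀ x ∈ l, (G.colourClass c).Adj x (m x)) →
      G.IsAlternating (c + 1) (m y :: (pairList m l ++ [a])) := by
  induction l with
  | nil =>
    intro y h hnd _
    simp only [pairList_nil, List.nil_append, List.nodup_cons, List.mem_singleton,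
      List.isChain_cons_cons] at h hnd ⊢
    exact ⟨hB _ _ hnd.1 h.1, trivial⟩
  | cons b l ih =>
    intro y h hnd hR
    simp only [pairList_cons, List.cons_append, List.isChain_cons_cons] at h hnd ⊢
    rw [List.nodup_cons] at hnd
    refine ⟨hB _ _ (fun h => hnd.1 (by simp [h])) h.1, ?_⟩
    rw [fin_two_add_one_add_one]
    exact ⟨hR b (by simp), ih h.2 (List.nodup_cons.1 hnd.2).2
      fun x hx => hR x (List.mem_cons_of_mem _ hx)⟩

/-- Cutting a matching cycle at the matching edge joining `a` and `m a`. -/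
theorem _root_.IsMatchingCycle.isAlternating {H : SimpleGraph V} {m : Equiv.Perm V} {c : Fin 2}
    {X : Finset V} {a : V} {l : List V} (h : IsMatchingCycle m H X a l)
    (hB : ∀ u v, u ≠ v → ¬ H.Adj u v → (G.colourClass (c + 1)).Adj u v)
    (hR : ∀ x ∈ l, (G.colourClass c).Adj x (m x)) :
    G.IsAlternating (c + 1) (m a :: (pairList m l ++ [a])) ∧
      (m a :: (pairList m l ++ [a])).Perm (pairList m (a :: l)) := by
  have hp : (m a :: (pairList m l ++ [a])).Perm (pairList m (a :: l)) := by
    rw [pairList_cons]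
    refine List.Perm.trans ?_ (List.Perm.swap _ _ _)
    exact List.Perm.cons _ (List.perm_append_singleton _ _)
  exact ⟨isAlternating_pairList hB h.chain (hp.nodup_iff.2 h.nodup) hR, hp⟩

end AlternatingLists

/-! ### Adding universal vertices -/

section UniversalVertices

variable {V : Type*} (G : EdgeColouredMultigraph V (Fin 2))

/-- The non-edges of colour `c`, on the vertex set enlarged by `δ` new vertices. -/
def missing (δ : ℕ) (c : Fin 2) : SimpleGraph (V ⊕ Fin δ) :=
  (G.colourClass c)ᶜ.map Function.Embedding.inl

/-- The multigraph obtained by adding `δ` new vertices, joined to all vertices in both colours. -/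
def addUniversal (δ : ℕ) : EdgeColouredMultigraph (V ⊕ Fin δ) (Fin 2) where
  colourClass c := (G.missing δ c)ᶜ

variable {G} {δ : ℕ} {c : Fin 2}

theorem missing_adj_inl {u v : V} :
    (G.missing δ c).Adj (.inl u) (.inl v) ↔ u ≠ v ∧ ¬ (G.colourClass c).Adj u v := by
  simp [missing]

theorem not_missing_adj_inr_left {i : Fin δ} {w : V ⊕ Fin δ} :
    ¬ (G.missing δ c).Adj (.inr i) w := by
  simp [missing]

theorem not_missing_adj_inr_right {i : Fin δ} {w : V ⊕ Fin δ} :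
    ¬ (G.missing δ c).Adj w (.inr i) := by
  simp [missing]

theorem addUniversal_adj_inl {u v : V} :
    ((G.addUniversal δ).colourClass c).Adj (.inl u) (.inl v) ↔ (G.colourClass c).Adj u v := by
  simp only [addUniversal, SimpleGraph.compl_adj, missing_adj_inl, ne_eq, Sum.inl.injEq]
  constructor
  · tauto
  · intro h
    exact ⟨h.ne, fun h' => h'.2 h⟩

theorem addUniversal_adj_of_not_missing_adj {u v : V ⊕ Fin δ} (huv : u ≠ v)
    (h : ¬ (G.missing δ c).Adj u v) : ((G.addUniversal δ).colourClass c).Adj u v :=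
  ⟨huv, h⟩

theorem IsAlternating.of_map_inl {l : List V} : ∀ {c : Fin 2},
    (G.addUniversal δ).IsAlternating c (l.map Sum.inl) → G.IsAlternating c l := by
  induction l with
  | nil => intros; trivial
  | cons a l ih =>
    intro c h
    cases l with
    | nil => trivial
    | cons b l => exact ⟨addUniversal_adj_inl.1 h.1, ih h.2⟩

/-- An alternating list through all old vertices and no new vertex. -/
theorem IsAlternating.hasProperHamiltonianPath_of_addUniversal [Nonempty V]
    {l : List (V ⊕ Fin δ)} (h : (G.addUniversal δ).IsAlternating c l) (hnd : l.Nodup)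
    (hmem : ∀ v, Sum.inl v ∈ l) (hnot : ∀ i, Sum.inr i ∉ l) : G.HasProperHamiltonianPath := by
  obtain ⟨l', rfl⟩ : ∃ l' : List V, l = l'.map Sum.inl := by
    have : ∀ w ∈ l, ∃ v : V, Sum.inl v = w := by
      rintro (v | i) hw
      · exact ⟨v, rfl⟩
      · exact absurd hw (hnot i)
    clear h hnd hmem hnot
    induction l with
    | nil => exact ⟨[], rfl⟩
    | cons a l ih =>
      obtain ⟨l', rfl⟩ := ih fun w hw => this w (List.mem_cons_of_mem _ hw)
      obtain ⟨v, rfl⟩ := this a (by simp)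
      exact ⟨v :: l', rfl⟩
  have hall : ∀ v, v ∈ l' := fun v => by simpa using hmem v
  refine h.of_map_inl.hasProperHamiltonianPath ?_ hnd.of_map hall
  obtain ⟨v⟩ := ‹Nonempty V›
  exact List.ne_nil_of_mem (hall v)

open Classical in
theorem degSumOn_missing [Fintype V] :
    degSumOn (G.missing δ c) Finset.univ = degSumOn (G.colourClass c)ᶜ Finset.univ := by
  simp only [degSumOn, degOn_eq_sum, Fintype.sum_sum_type, missing_adj_inl,
    not_missing_adj_inr_left, not_missing_adj_inr_right, if_false, Finset.sum_const_zero, add_zero,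
    SimpleGraph.compl_adj]

end UniversalVertices

end EdgeColouredMultigraph

/-! ### Existence of the path, by parity of the order -/

namespace EdgeColouredMultigraph

section Existence

open Finset

open Classical in
/-- If every vertex is incident with an edge of colour `c`, then adding `δ ≤ 2` universal vertices
yields a perfect matching in colour `c`, unless many edges of colour `c` are missing. -/
theorem exists_perm_addUniversal {V : Type*} [Fintype V] {G : EdgeColouredMultigraph V (Fin 2)}
    {c : Fin 2} {δ : ℕ} (hn : 14 ≤ Fintype.card V) (hδ : 1 ≤ δ) (hδ2 : δ ≤ 2)
    (heven : Even (Fintype.card V + δ)) (hdeg : ∀ x, ∃ y, (G.colourClass c).Adj x y)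
    (hmiss : degSumOn (G.colourClass c)ᶜ univ + 20 ≤ 6 * Fintype.card V) :
    ∃ m : Equiv.Perm (V ⊕ Fin δ), (∀ w, m (m w) = w) ∧
      ∀ w, ((G.addUniversal δ).colourClass c).Adj w (m w) := by
  suffices h : ∃ M : (G.missing δ c)ᶜ.Subgraph, M.IsPerfectMatching by
    obtain ⟨M, hM⟩ := h
    exact exists_perm_of_isPerfectMatching hM
  by_contra! hM
  have hcard : Fintype.card (V ⊕ Fin δ) = Fintype.card V + δ := by simp
  obtain ⟨s, h1, h2, h3, h4⟩ := le_degSumOn_of_forall_not_isPerfectMatching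
    (H := G.missing δ c) (by rwa [hcard]) hM (Z := univ.image Sum.inr)
    (by
      intro z hz w
      obtain ⟨i, -, rfl⟩ := mem_image.1 hz
      exact not_missing_adj_inr_left)
    (by
      rintro (v | i) hw
      · obtain ⟨y, hy⟩ := hdeg v
        exact ⟨.inl y, by simp, addUniversal_adj_inl.2 hy⟩
      · simp at hw)
  have hZ : #(univ.image (Sum.inr : Fin δ → V ⊕ Fin δ)) = δ := by
    rw [card_image_of_injective _ Sum.inr_injective, card_univ, Fintype.card_fin]
  rw [hZ] at h1 h4
  rw [degSumOn_missing, hcard] at h3 h4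
  rw [hcard] at h2
  rw [Nat.even_iff] at heven
  -- For `s = δ` the components have at least three vertices, and 6n - 18 exceeds 6n - 20.
  rcases eq_or_lt_of_le h1 with rfl | h1
  · have := h4 rfl
    omega
  obtain ⟨r, hr⟩ := Nat.exists_eq_add_of_le h2
  have h5 : 2 * (Fintype.card V + δ) - 3 * s - 2 = s + 2 + 2 * r := by omega
  rw [h5] at h3
  have h6 := h3.trans (Nat.le_sub_of_add_le hmiss)
  have h7 : Fintype.card V = 2 * s + 2 + r - δ := by omega
  -- For fixed `s` the inequality is linear in the surplus `r`; `14 ≤ n` excludes exceptions such as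
  -- n = 13 with s = 6, r = 0, δ = 1. For larger `s` the quadratic term wins.
  by_cases hs : s ≤ 7
  · interval_cases s <;> omega
  · have : 6 * Fintype.card V - 20 ≤ 12 * s + 6 * r := by omega
    nlinarith

open Classical in
/-- A graph of even order without isolated vertices and without a perfect matching misses at least
`2 * n - 5` edges. -/
theorem exists_perm_of_degSumOn_lt {V : Type*} [Fintype V] {R : SimpleGraph V}
    (hn : 14 ≤ Fintype.card V) (heven : Even (Fintype.card V)) (hdeg : ∀ x, ∃ y, R.Adj x y)
    (hmiss : degSumOn Rᶜ univ + 10 < 4 * Fintype.card V) :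
    ∃ m : Equiv.Perm V, (∀ w, m (m w) = w) ∧ ∀ w, R.Adj w (m w) := by
  suffices h : ∃ M : Rᶜᶜ.Subgraph, M.IsPerfectMatching by
    obtain ⟨M, hM⟩ := h
    obtain ⟨m, h1, h2⟩ := exists_perm_of_isPerfectMatching hM
    rw [compl_compl] at h2
    exact ⟨m, h1, h2⟩
  by_contra! hM
  obtain ⟨s, -, h2, h3, h4⟩ := le_degSumOn_of_forall_not_isPerfectMatching
    (H := Rᶜ) heven hM (Z := ∅) (by simp) (by
      intro w _
      obtain ⟨y, hy⟩ := hdeg w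
      exact ⟨y, by simp, by rwa [compl_compl]⟩)
  rw [card_empty] at h4
  rw [Nat.even_iff] at heven
  -- The extreme case is s = 1, where the bound is 2(2n - 5).
  rcases Nat.eq_zero_or_pos s with rfl | h1
  · have := h4 rfl
    omega
  obtain ⟨r, hr⟩ := Nat.exists_eq_add_of_le h2
  have h5 : 2 * Fintype.card V - 3 * s - 2 = s + 2 + 2 * r := by omega
  rw [h5] at h3
  have h6 := h3.trans (Nat.le_sub_of_add_le hmiss.le)
  by_cases hs : s ≤ 7
  · interval_cases s <;> omega
  · have : 4 * Fintype.card V - 10 ≤ 8 * s + 4 * r := by omega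
    nlinarith

variable {V : Type*} [Fintype V] {G : EdgeColouredMultigraph V (Fin 2)} {c : Fin 2}

open Classical in
theorem hasProperHamiltonianPath_of_odd (hn : 14 ≤ Fintype.card V)
    (hodd : Odd (Fintype.card V)) (hdeg : ∀ c x, ∃ y, (G.colourClass c).Adj x y)
    (hmiss : degSumOn (G.colourClass c)ᶜ univ + 20 ≤ 6 * Fintype.card V)
    (hmiss' : degSumOn (G.colourClass (c + 1))ᶜ univ + 10 ≤ 3 * Fintype.card V) :
    G.HasProperHamiltonianPath := by
  have : Nonempty V := Fintype.card_pos_iff.1 (by omega)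
  obtain ⟨m, hm, hadj⟩ := exists_perm_addUniversal (δ := 1) hn le_rfl one_le_two hodd.add_one
    (hdeg c) hmiss
  obtain ⟨q, hq⟩ := hodd
  -- For odd n, parity improves 3n - 10 to 3n - 11, exactly what the cycle theorem needs on n + 1
  -- vertices.
  have hev := even_degSumOn (H := (G.colourClass (c + 1))ᶜ) univ
  rw [Nat.even_iff] at hev
  have hcard : #(univ : Finset (V ⊕ Fin 1)) = 2 * (q + 1) := by
    rw [card_univ, Fintype.card_sum, Fintype.card_fin]
    omega
  obtain ⟨a, l, h⟩ := exists_isMatchingCycle_of_exists_not_adj (H := G.missing 1 (c + 1)) (q + 1) m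
    univ hm (fun w => (hadj w).ne') (fun _ _ => mem_univ _) hcard
    (by rw [degSumOn_missing]; omega) (by
      rintro (v | i) -
      -- The new vertex is a non-neighbour of `v` in the missing graph, unless it is the partner of
      -- `v`; then an edge of colour `c + 1` in `G` helps.
      · by_cases hv : m (.inl v) = .inr 0
        · obtain ⟨y, hy⟩ := hdeg (c + 1) v
          refine ⟨.inl y, mem_univ _, by simpa using hy.ne', by simp [hv], ?_⟩
          rw [missing_adj_inl]
          tauto
        · exact ⟨.inr 0, mem_univ _, by simp, Ne.symm hv, not_missing_adj_inr_right⟩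
      · obtain ⟨z, hz, h1, h2, h3⟩ := exists_not_adj_of_degOn_lt (H := G.missing 1 (c + 1))
          (X := univ) (y := .inr i) (.inr i) (m (.inr i)) (by
            have : degOn (G.missing 1 (c + 1)) univ (.inr i) = 0 := by
              simp [degOn, not_missing_adj_inr_left]
            omega)
        exact ⟨z, hz, h1, h2, h3⟩)
  obtain ⟨l, h⟩ := h.exists_start hm (mem_univ (.inr 0))
  obtain ⟨halt, hp⟩ := h.isAlternating (G := G.addUniversal 1) (c := c)
    (fun u v huv h => addUniversal_adj_of_not_missing_adj huv h) fun x _ => hadj x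
  have hnd := hp.nodup_iff.2 h.nodup
  have hmem : ∀ w, w ∈ m (.inr 0) :: (pairList m l ++ [.inr 0]) := fun w => by
    rw [hp.mem_iff, h.mem_iff]
    exact mem_univ w
  rw [← List.cons_append] at halt hnd hmem
  refine halt.left_of_append.hasProperHamiltonianPath_of_addUniversal
    (List.nodup_append.1 hnd).1 (fun v => by simpa using hmem (.inl v)) fun i hi => ?_
  rw [Subsingleton.elim i 0] at hi
  exact (List.nodup_append.1 hnd).2.2 _ hi _ (by simp) rfl

-- The new vertices are consecutive on the cycle, so removing both leaves a single path.
open Classical in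
theorem hasProperHamiltonianPath_of_even_of_matching (hn : 14 ≤ Fintype.card V)
    (heven : Even (Fintype.card V))
    (hmiss : degSumOn (G.colourClass (c + 1))ᶜ univ + 10 ≤ 3 * Fintype.card V)
    {m : Equiv.Perm (V ⊕ Fin 2)} (hm : ∀ w, m (m w) = w)
    (hadj : ∀ w, ((G.addUniversal 2).colourClass c).Adj w (m w))
    (hm0 : m (.inr 0) = .inr 1) : G.HasProperHamiltonianPath := by
  have : Nonempty V := Fintype.card_pos_iff.1 (by omega)
  obtain ⟨q, hq⟩ := heven
  have hcard : #(univ : Finset (V ⊕ Fin 2)) = 2 * (q + 1) := by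
    rw [card_univ, Fintype.card_sum, Fintype.card_fin]
    omega
  have hm1 : m (.inr 1) = .inr 0 := by rw [← hm0, hm]
  obtain ⟨a, l, h⟩ := exists_isMatchingCycle_of_exists_not_adj (H := G.missing 2 (c + 1)) (q + 1) m
    univ hm (fun w => (hadj w).ne') (fun _ _ => mem_univ _) hcard
    (by rw [degSumOn_missing]; omega) (by
      rintro (v | i) -
      · refine ⟨.inr 0, mem_univ _, by simp, fun h => ?_, not_missing_adj_inr_right⟩
        rw [h, hm] at hm0
        cases hm0
      · refine ⟨.inl (Classical.arbitrary V), mem_univ _, by simp, ?_, not_missing_adj_inr_left⟩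
        fin_cases i <;> simp [hm0, hm1])
  obtain ⟨l, h⟩ := h.exists_start hm (mem_univ (.inr 0))
  obtain ⟨halt, hp⟩ := h.isAlternating (G := G.addUniversal 2) (c := c)
    (fun u v huv h => addUniversal_adj_of_not_missing_adj huv h) fun x _ => hadj x
  have hnd := hp.nodup_iff.2 h.nodup
  have hmem : ∀ w, w ∈ m (.inr 0) :: (pairList m l ++ [.inr 0]) := fun w => by
    rw [hp.mem_iff, h.mem_iff]
    exact mem_univ w
  rw [hm0] at halt hnd hmem
  rw [List.nodup_cons] at hnd
  refine halt.tail.left_of_append.hasProperHamiltonianPath_of_addUniversal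
    (List.nodup_append.1 hnd.2).1 (fun v => by simpa using hmem (.inl v)) fun i hi => ?_
  fin_cases i
  · exact (List.nodup_append.1 hnd.2).2.2 _ hi _ (by simp) rfl
  · exact hnd.1 (List.mem_append_left _ hi)

-- The exchange deletes both new vertices and pairs their partners. This pair need not be an edge of
-- colour `c`, so the cycle is cut there.
open Classical in
theorem hasProperHamiltonianPath_of_even_of_nearMatching
    (heven : Even (Fintype.card V))
    (hmiss : degSumOn (G.colourClass (c + 1))ᶜ univ + 10 ≤ 2 * Fintype.card V)
    {m : Equiv.Perm (V ⊕ Fin 2)} (hm : ∀ w, m (m w) = w)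
    (hadj : ∀ w, ((G.addUniversal 2).colourClass c).Adj w (m w))
    (hne : m (.inr 0) ≠ .inr 1) : G.HasProperHamiltonianPath := by
  have : Nonempty V := Fintype.card_pos_iff.1 (by omega)
  obtain ⟨q, hq⟩ := heven
  have hfix : ∀ w, m w ≠ w := fun w => (hadj w).ne'
  have h01 : (Sum.inr 0 : V ⊕ Fin 2) ≠ .inr 1 := by simp
  have hXcard := card_erase_erase (mem_univ _) (mem_univ _) h01
  have hcard : #(univ : Finset (V ⊕ Fin 2)) = 2 * (q + 1) := by
    rw [card_univ, Fintype.card_sum, Fintype.card_fin]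
    omega
  have hdeg := degSumOn_erase_erase (H := G.missing 2 (c + 1)) (mem_univ _) (mem_univ _) h01
    not_missing_adj_inr_left
  rw [degSumOn_missing] at hdeg
  obtain ⟨a, l, h⟩ := exists_isMatchingCycle_of_degSumOn_le (H := G.missing 2 (c + 1)) q
    (exchange m (.inr 0) (.inr 1)) _ (exchange_exchange hm _ _) (exchange_ne_self hfix _ _)
    (exchange_mem hm (fun _ _ => mem_univ _) (mem_univ _) (mem_univ _) hfix h01 hne)
    (by omega) (by omega)
  have hex := exchange_apply_partner hm (hfix (.inr 0)) h01
  have h0 : m (.inr 0) ∈ ((univ : Finset (V ⊕ Fin 2)).erase (.inr 0)).erase (.inr 1) := by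
    simp [hne, hfix]
  obtain ⟨l, h⟩ := h.exists_start (exchange_exchange hm _ _) h0
  have hmem' := h.mem_iff
  have hnd' := h.nodup
  simp only [pairList_cons, hex, List.nodup_cons, List.mem_cons, not_or] at hnd' hmem'
  obtain ⟨halt, hp⟩ := h.isAlternating (G := G.addUniversal 2) (c := c)
    (fun u v huv h => addUniversal_adj_of_not_missing_adj huv h) fun x hx => by
      have hx' : x ∈ pairList (exchange m (.inr 0) (.inr 1)) l := mem_pairList.2 ⟨x, hx, Or.inl rfl⟩
      have hx2 := (hmem' x).1 (Or.inr (Or.inr hx'))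
      simp only [mem_erase] at hx2
      rw [exchange_apply_of_ne hm hx2.2.1 hx2.1 (fun h => hnd'.1.2 (h ▸ hx'))
        fun h => hnd'.2.1 (h ▸ hx')]
      exact hadj x
  refine halt.hasProperHamiltonianPath_of_addUniversal (hp.nodup_iff.2 h.nodup)
    (fun v => ?_) fun i => ?_
  · rw [hp.mem_iff, h.mem_iff]
    simp
  · rw [hp.mem_iff, h.mem_iff]
    fin_cases i <;> simp

open Classical in
theorem hasProperHamiltonianPath_of_degSumOn_le (hn : 14 ≤ Fintype.card V)
    (hdeg : ∀ c x, ∃ y, (G.colourClass c).Adj x y)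
    (hmiss : degSumOn (G.colourClass c)ᶜ univ + degSumOn (G.colourClass (c + 1))ᶜ univ + 20 ≤
      6 * Fintype.card V)
    (hle : degSumOn (G.colourClass (c + 1))ᶜ univ ≤ degSumOn (G.colourClass c)ᶜ univ) :
    G.HasProperHamiltonianPath := by
  rcases Nat.even_or_odd (Fintype.card V) with heven | hodd
  · obtain ⟨m, hm, hadj⟩ := exists_perm_addUniversal (δ := 2) hn one_le_two le_rfl
      (heven.add even_two) (hdeg c) (by omega)
    by_cases hm0 : m (.inr 0) = .inr 1
    · exact hasProperHamiltonianPath_of_even_of_matching hn heven (by omega) hm hadj hm0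
    -- If this fails, the total 6n - 20 leaves at most 2n - 10 for the degree sum of colour `c + 1`.
    by_cases h : degSumOn (G.colourClass c)ᶜ univ + 10 < 4 * Fintype.card V
    · obtain ⟨m, hm, hadj⟩ := exists_perm_of_degSumOn_lt hn heven (hdeg c) h
      refine hasProperHamiltonianPath_of_even_of_matching (c := c) hn heven (by omega)
        (m := Equiv.sumCongr m (Equiv.swap 0 1)) ?_ ?_ (by simp)
      · rintro (v | i) <;> simp [hm]
      · rintro (v | i)
        · exact addUniversal_adj_inl.2 (hadj v)
        · refine addUniversal_adj_of_not_missing_adj ?_ not_missing_adj_inr_left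
          fin_cases i <;> simp
    · exact hasProperHamiltonianPath_of_even_of_nearMatching heven (by omega) hm hadj hm0
  · exact hasProperHamiltonianPath_of_odd (c := c) hn hodd hdeg (by omega) (by omega)

end Existence

end EdgeColouredMultigraph

/-! ### Translating the edge count -/

namespace EdgeColouredMultigraph

open Finset

theorem two_mul_ncard_edgeSet_add_degSumOn_compl {V : Type*} [Fintype V] (K : SimpleGraph V)
    [DecidableRel Kᶜ.Adj] :
    2 * K.edgeSet.ncard + degSumOn Kᶜ univ = Fintype.card V * (Fintype.card V - 1) := by
  classical
  have h1 : K.edgeSet.ncard = #K.edgeFinset := by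
    rw [← SimpleGraph.coe_edgeFinset, Set.ncard_coe_finset]
  have h2 : degSumOn Kᶜ univ = ∑ v, Kᶜ.degree v := by
    refine sum_congr rfl fun v _ => ?_
    rw [← SimpleGraph.card_neighborFinset_eq_degree, SimpleGraph.neighborFinset_eq_filter, degOn]
  rw [h1, ← SimpleGraph.sum_degrees_eq_twice_card_edges, h2, ← sum_add_distrib]
  have h3 : ∀ v, K.degree v + Kᶜ.degree v = Fintype.card V - 1 := fun v => by
    have := K.degree_lt_card_verts v
    rw [SimpleGraph.degree_compl]
    omega
  rw [sum_congr rfl fun v _ => h3 v, sum_const, card_univ, smul_eq_mul]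

theorem exists_adj_of_rainbowDegree_eq_two {V : Type*} {G : EdgeColouredMultigraph V (Fin 2)}
    (h : G.rainbowDegree = 2) (c : Fin 2) (x : V) : ∃ y, (G.colourClass c).Adj x y := by
  have h1 : 2 ≤ G.vertexRainbowDegree x :=
    h.ge.trans (ciInf_le (OrderBot.bddBelow _) x)
  have h2 : {i : Fin 2 | ∃ y : V, (G.colourClass i).Adj x y} = Set.univ := by
    refine Set.eq_of_subset_of_ncard_le (Set.subset_univ _) ?_
    rw [Set.ncard_univ, Nat.card_eq_fintype_card, Fintype.card_fin]
    exact h1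
  have := Set.mem_univ c
  rwa [← h2] at this

theorem two_mul_choose_two (n : ℕ) : 2 * n.choose 2 = n * (n - 1) := by
  rw [Nat.choose_two_right, Nat.mul_div_cancel' (Nat.even_mul_pred_self n).two_dvd]

theorem hasProperHamiltonianPath_of_le_numEdges {V : Type*} [Fintype V]
    {G : EdgeColouredMultigraph V (Fin 2)} (hn : 14 ≤ Fintype.card V) (hG : G.rainbowDegree = 2)
    (hm : (Fintype.card V).choose 2 + (Fintype.card V - 3).choose 2 + 4 ≤ G.numEdges) :
    G.HasProperHamiltonianPath := by
  classical
  have h0 := two_mul_ncard_edgeSet_add_degSumOn_compl (G.colourClass 0)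
  have h1 := two_mul_ncard_edgeSet_add_degSumOn_compl (G.colourClass 1)
  have h2 := two_mul_choose_two (Fintype.card V)
  have h3 := two_mul_choose_two (Fintype.card V - 3)
  rw [numEdges, Fin.sum_univ_two] at hm
  have hmiss : degSumOn (G.colourClass 0)ᶜ univ + degSumOn (G.colourClass 1)ᶜ univ + 20 ≤
      6 * Fintype.card V := by
    obtain ⟨k, hk⟩ := Nat.exists_eq_add_of_le hn
    rw [hk] at h0 h1 h2 h3 hm ⊢
    rw [show 14 + k - 1 = 13 + k by omega] at h0 h1 h2
    rw [show 14 + k - 3 - 1 = 10 + k by omega, show 14 + k - 3 = 11 + k by omega] at h3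
    rw [show 14 + k - 3 = 11 + k by omega] at hm
    nlinarith
  have hdeg := exists_adj_of_rainbowDegree_eq_two hG
  rcases le_total (degSumOn (G.colourClass 1)ᶜ univ) (degSumOn (G.colourClass 0)ᶜ univ) with h | h
  · exact hasProperHamiltonianPath_of_degSumOn_le (c := 0) hn hdeg hmiss h
  · exact hasProperHamiltonianPath_of_degSumOn_le (c := 1) hn hdeg (by
      rw [add_comm (degSumOn _ _)]; exact hmiss) h

/-! ### The extremal example for odd order -/

section Sharpness

variable {n : ℕ}

/-- The complete graph on the vertices `3, …, n - 1`, together with the edges joining the vertices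
`0, 1, 2` to the vertex `3`. -/
def pendantGraph (n : ℕ) : SimpleGraph (Fin n) where
  Adj x y := x ≠ y ∧ ((3 ≤ (x : ℕ) ∧ 3 ≤ (y : ℕ)) ∨ (x : ℕ) = 3 ∨ (y : ℕ) = 3)
  symm := ⟨fun x y h => ⟨h.1.symm, by tauto⟩⟩
  loopless := ⟨fun x h => h.1 rfl⟩

/-- One colour class is complete, the other one has three pendant edges at a common vertex. -/
def sharpMultigraph (n : ℕ) : EdgeColouredMultigraph (Fin n) (Fin 2) where
  colourClass c := if c = 0 then pendantGraph n else ⊤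

theorem pendantGraph_adj_of_lt {x y : Fin n} (hx : (x : ℕ) < 3) (h : (pendantGraph n).Adj x y) :
    (y : ℕ) = 3 := by
  obtain ⟨-, h⟩ := h
  omega

/-- Missing are 3 edges among the vertices 0, 1, 2 and 3(n - 4) from these to the vertices beyond 3:
one edge too many for the theorem. -/
theorem degSumOn_pendantGraph_compl [DecidableRel (pendantGraph n)ᶜ.Adj] (hn : 4 ≤ n) :
    degSumOn (pendantGraph n)ᶜ univ = 6 * n - 18 := by
  obtain ⟨k, rfl⟩ := Nat.exists_eq_add_of_le' hn
  have h1 : ∀ x y : Fin (k + 4), (pendantGraph (k + 4))ᶜ.Adj x y ↔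
      (x : ℕ) ≠ y ∧ ((x : ℕ) < 3 ∧ (y : ℕ) ≠ 3 ∨ (y : ℕ) < 3 ∧ (x : ℕ) ≠ 3) := by
    intro x y
    simp only [SimpleGraph.compl_adj, pendantGraph, ne_eq, Fin.ext_iff]
    omega
  simp only [degSumOn, degOn_eq_sum, h1]
  have h2 : ∀ a : ℕ, ¬ a + 1 + 1 + 1 + 1 < 3 := by omega
  simp [Fin.sum_univ_succ, h2, -sum_boole]
  omega

theorem numEdges_sharpMultigraph (hn : 4 ≤ n) :
    (sharpMultigraph n).numEdges = n.choose 2 + (n - 3).choose 2 + 3 := by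
  classical
  have h0 := two_mul_ncard_edgeSet_add_degSumOn_compl (pendantGraph n)
  have h1 := two_mul_ncard_edgeSet_add_degSumOn_compl (⊤ : SimpleGraph (Fin n))
  have h2 := two_mul_choose_two n
  have h3 := two_mul_choose_two (n - 3)
  have h4 : degSumOn (⊤ : SimpleGraph (Fin n))ᶜ univ = 0 := by
    simp [degSumOn, degOn]
  have h5 : (sharpMultigraph n).numEdges =
      (pendantGraph n).edgeSet.ncard + (⊤ : SimpleGraph (Fin n)).edgeSet.ncard := by
    simp [numEdges, sharpMultigraph]
  rw [degSumOn_pendantGraph_compl hn, Fintype.card_fin] at h0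
  rw [h4, Fintype.card_fin] at h1
  rw [h5]
  obtain ⟨k, rfl⟩ := Nat.exists_eq_add_of_le' hn
  rw [show k + 4 - 1 = k + 3 by omega] at h0 h1 h2
  rw [show k + 4 - 3 - 1 = k by omega, show k + 4 - 3 = k + 1 by omega] at h3
  rw [show 6 * (k + 4) - 18 = 6 * k + 6 by omega] at h0
  rw [show k + 4 - 3 = k + 1 by omega]
  nlinarith

theorem rainbowDegree_sharpMultigraph (hn : 5 ≤ n) : (sharpMultigraph n).rainbowDegree = 2 := by
  have : Nonempty (Fin n) := ⟨⟨0, by omega⟩⟩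
  have h : ∀ x, (sharpMultigraph n).vertexRainbowDegree x = 2 := by
    intro x
    have h1 : {i : Fin 2 | ∃ y, ((sharpMultigraph n).colourClass i).Adj x y} = Set.univ := by
      rw [Set.eq_univ_iff_forall]
      intro i
      have h2 : ∃ y, (pendantGraph n).Adj x y := by
        by_cases hx : (x : ℕ) = 3
        · exact ⟨⟨4, by omega⟩, fun h => by simp [h] at hx, by simp [hx]⟩
        · exact ⟨⟨3, by omega⟩, fun h => by simp [h] at hx, by simp⟩
      obtain ⟨y, hy⟩ := h2
      refine ⟨y, ?_⟩
      by_cases hi : i = 0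
      · simpa [sharpMultigraph, hi] using hy
      · simpa [sharpMultigraph, hi] using hy.ne
    rw [vertexRainbowDegree, h1, Set.ncard_univ, Nat.card_eq_fintype_card, Fintype.card_fin]
  rw [rainbowDegree, iInf_congr h, ciInf_const]

/-- In a path of even length with alternating colours, all but one of the vertices are incident with
a path edge of colour `0`. -/
theorem not_hasProperHamiltonianPath_sharpMultigraph (hn : 4 ≤ n) (hodd : Odd n) :
    ¬ (sharpMultigraph n).HasProperHamiltonianPath := by
  rintro ⟨k, v, c, hP, hsurj⟩
  have hk : k + 1 = n := by
    simpa using Fintype.card_congr (Equiv.ofBijective v ⟨hP.injective, hsurj⟩)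
  -- `r` is the parity of the positions of the colour 0 edges.
  obtain ⟨r, hr, hc⟩ : ∃ r < 2, ∀ (i : ℕ) (h : i < k), i % 2 = r → c ⟨i, h⟩ = 0 := by
    have hstep : ∀ (i : ℕ) (h : i + 1 < k), c ⟨i + 1, h⟩ = c ⟨i, by omega⟩ + 1 := by
      intro i h
      have h1 := hP.proper ⟨i, by omega⟩ ⟨i + 1, h⟩ rfl
      revert h1
      generalize c ⟨i + 1, h⟩ = a
      generalize c ⟨i, _⟩ = b
      revert a b
      decide
    have htwo : ∀ a : Fin 2, (a + 1 = 0 ↔ a ≠ 0) := by decide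
    have hall : ∀ (i : ℕ) (h : i < k), (c ⟨i, h⟩ = 0 ↔ (i % 2 = 0 ↔ c ⟨0, by omega⟩ = 0)) := by
      intro i
      induction i with
      | zero => intro h; simp
      | succ i ih =>
        intro h
        rw [hstep i h, htwo, ne_eq, ih (by omega), show (i + 1) % 2 = 0 ↔ ¬ i % 2 = 0 by omega]
        tauto
    by_cases h0 : c ⟨0, by omega⟩ = 0
    · exact ⟨0, by omega, fun i h hi => (hall i h).2 (by simp [h0, hi])⟩
    · exact ⟨1, by omega, fun i h hi => (hall i h).2 (by simp [h0, hi])⟩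
  have hred : ∀ (i : ℕ) (h : i < k), i % 2 = r →
      (pendantGraph n).Adj (v ⟨i, by omega⟩) (v ⟨i + 1, by omega⟩) := by
    intro i h hi
    have := hP.adj ⟨i, h⟩
    rw [hc i h hi] at this
    simpa [sharpMultigraph] using this
  obtain ⟨p, hp⟩ := hsurj ⟨3, by omega⟩
  have hpos : ∀ q : Fin (k + 1), (v q : ℕ) = 3 → (q : ℕ) = p := fun q hq =>
    congrArg Fin.val (hP.injective (hp ▸ Fin.ext hq))
  have hnext : ∀ j : Fin (k + 1), (v j : ℕ) < 3 → (j : ℕ) < k → (j : ℕ) % 2 = r →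
      (j : ℕ) + 1 = p := fun j hj h1 h2 =>
    hpos ⟨j + 1, by omega⟩ (pendantGraph_adj_of_lt hj (hred j h1 h2))
  have hprev : ∀ j : Fin (k + 1), (v j : ℕ) < 3 → 1 ≤ (j : ℕ) → ((j : ℕ) - 1) % 2 = r →
      (j : ℕ) - 1 = p := fun j hj h1 h2 => by
    obtain ⟨i, hi⟩ := Nat.exists_eq_add_of_le' h1
    have h3 := hred i (by omega) (by omega)
    have h4 : (⟨i + 1, by omega⟩ : Fin (k + 1)) = j := Fin.ext hi.symm
    rw [h4] at h3
    have := hpos _ (pendantGraph_adj_of_lt hj h3.symm)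
    simp only at this
    omega
  obtain ⟨j₀, h₀⟩ := hsurj ⟨0, by omega⟩
  obtain ⟨j₁, h₁⟩ := hsurj ⟨1, by omega⟩
  obtain ⟨j₂, h₂⟩ := hsurj ⟨2, by omega⟩
  have hne : ∀ i j : Fin (k + 1), v i ≠ v j → (i : ℕ) ≠ j := fun i j h h' => h (by rw [Fin.ext h'])
  have h01 := hne j₀ j₁ (by simp [h₀, h₁])
  have h02 := hne j₀ j₂ (by simp [h₀, h₂])
  have h12 := hne j₁ j₂ (by simp [h₁, h₂])
  rw [Nat.odd_iff] at hodd
  obtain ⟨e, hcov⟩ : ∃ e, ∀ j : Fin (k + 1), (v j : ℕ) < 3 → (j : ℕ) ≠ e →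
      ((j : ℕ) % 2 = r ∧ (j : ℕ) + 1 = p) ∨ ((j : ℕ) % 2 ≠ r ∧ (j : ℕ) = p + 1) := by
    -- As `k` is even, the end missed by colour 0 is the last vertex if `r = 0` and the first if `r
    -- = 1`.
    refine ⟨if r = 0 then k else 0, fun j hj hje => ?_⟩
    have h3 := hnext j hj
    have h4 := hprev j hj
    have h5 := j.2
    interval_cases r
    · rw [if_pos rfl] at hje
      omega
    · rw [if_neg one_ne_zero] at hje
      omega
  have c0 := hcov j₀ (by simp [h₀])
  have c1 := hcov j₁ (by simp [h₁])
  have c2 := hcov j₂ (by simp [h₂])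
  clear hcov hprev hnext hpos
  generalize (j₀ : ℕ) = x at *
  generalize (j₁ : ℕ) = y at *
  generalize (j₂ : ℕ) = z at *
  -- At least two of the three positions differ from `e`. Each of those two is matched to `p` in
  -- colour 0, on the side that the parity of `p` dictates, so they coincide.
  omega

end Sharpness

end EdgeColouredMultigraph

theorem theorem2 (n : ℕ) (hn : 14 ≤ n) :
    (∀ (V : Type*) [Fintype V] (G : EdgeColouredMultigraph V (Fin 2)),
      Fintype.card V = n →
      G.rainbowDegree = 2 →
      n.choose 2 + (n - 3).choose 2 + 4 ≤ G.numEdges →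
      G.HasProperHamiltonianPath) ∧
    (Odd n → ∃ G : EdgeColouredMultigraph (Fin n) (Fin 2),
      G.rainbowDegree = 2 ∧
      G.numEdges = n.choose 2 + (n - 3).choose 2 + 3 ∧
      ¬ G.HasProperHamiltonianPath) := by
  refine ⟨?_, fun hodd => ⟨EdgeColouredMultigraph.sharpMultigraph n,
    EdgeColouredMultigraph.rainbowDegree_sharpMultigraph (by omega),
    EdgeColouredMultigraph.numEdges_sharpMultigraph (by omega),
    EdgeColouredMultigraph.not_hasProperHamiltonianPath_sharpMultigraph (by omega) hodd⟩⟩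
  rintro V _ G rfl hG hm
  exact EdgeColouredMultigraph.hasProperHamiltonianPath_of_le_numEdges hn hG hm
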